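/- Define sequences of non-negative integers $(X(n))_{n\ge 0}$ and $(Y(n))_{n\ge 0}$ as follows. Put $X(0)=Y(0)=0$, $X(1)=1$, $Y(1)=2$. For $n>1$, call a pair of positive integers $(x,y)$ with $y>x$ \emph{admissible} (at step $n$) if neither $x$ nor $y$ belongs to $\{X(k) : 1\le k<n\}\cup\{Y(k) : 1\le k<n\}$ and $y-x$ belongs neither to $\{Y(k)-X(k) : 1\le k<n\}$ nor to $\{Y(k)+X(k) : 1\le k<n\}$. Let $X(n)$ be the least $x$ for which some pair $(x,y)$ is admissible, and let $Y(n)$ be the least $y$ for which $(X(n),y)$ is admissible. Then for all $n\ge 1$, either $$X(Y(n))=X(n)+Y(n)\qquad\text{or}\qquad X(Y(n))=X(n)+Y(n)-1.$$ -/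

import Mathlib

namespace TribGame

/-- `IsGood S x y`: the candidate values `x < y` (positive integers) are admissible, where `S` is
the set of the earlier pairs `(X k, Y k)`, `1 ≤ k < n`. Neither `x` nor `y` is an earlier value of
`X` or of `Y`, and `y - x` is neither an earlier difference `Y k - X k` nor an earlier sum
`Y k + X k` (differences are taken in `ℤ`). -/
def IsGood (S : Finset (ℕ × ℕ)) (x y : ℕ) : Prop :=
  0 < x ∧ x < y ∧
    ∀ p ∈ S, (x ≠ p.1 ∧ x ≠ p.2) ∧ (y ≠ p.1 ∧ y ≠ p.2) ∧
      (y : ℤ) - x ≠ (p.2 : ℤ) - p.1 ∧ (y : ℤ) - x ≠ (p.2 : ℤ) + p.1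

theorem exists_isGood (S : Finset (ℕ × ℕ)) : ∃ x y, IsGood S x y := by
  have hb : ∀ p ∈ S, p.1 + p.2 ≤ ∑ q ∈ S, (q.1 + q.2) := fun p hp =>
    Finset.single_le_sum (f := fun q : ℕ × ℕ => q.1 + q.2) (fun _ _ => Nat.zero_le _) hp
  refine ⟨∑ q ∈ S, (q.1 + q.2) + 1, 2 * (∑ q ∈ S, (q.1 + q.2)) + 2, by omega, by omega, ?_⟩
  intro p hp
  have := hb p hp
  refine ⟨⟨?_, ?_⟩, ⟨?_, ?_⟩, ?_, ?_⟩ <;> omega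

open Classical in
/-- The least `x` that can be completed to an admissible pair. -/
noncomputable def nextX (S : Finset (ℕ × ℕ)) : ℕ := Nat.find (exists_isGood S)

theorem exists_isGood_nextX (S : Finset (ℕ × ℕ)) : ∃ y, IsGood S (nextX S) y := by
  classical
  exact Nat.find_spec (exists_isGood S)

open Classical in
/-- The least `y` such that `(nextX S, y)` is admissible. -/
noncomputable def nextY (S : Finset (ℕ × ℕ)) : ℕ := Nat.find (exists_isGood_nextX S)

/-- The pairs `(X n, Y n)`: start with `(0, 0)` and `(1, 2)`; for `n > 1` make the least
admissible choice with respect to the pairs of index `1, …, n - 1`. -/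
noncomputable def XY : ℕ → ℕ × ℕ
  | 0 => (0, 0)
  | 1 => (1, 2)
  | n + 2 =>
    let S : Finset (ℕ × ℕ) := Finset.univ.image fun k : Fin (n + 1) => XY (k.val + 1)
    (nextX S, nextY S)
  termination_by n => n
  decreasing_by omega

/-- The sequence `X = 0, 1, 3, 4, 6, 7, 9, 10, 12, …`. -/
noncomputable def X (n : ℕ) : ℕ := (XY n).1

/-- The sequence `Y = 0, 2, 5, 8, 11, 13, 16, 19, 22, …`. -/
noncomputable def Y (n : ℕ) : ℕ := (XY n).2

end TribGame

/-! Let t be the Tribonacci word, fixed by σ = `tribMor`. With indices shifted by one, X, Y - X and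
Y are `letterSeq 0`, `letterSeq 1` and their sum. The values of X and Y partition the positive
integers, and so do the differences and sums (`letterSeq_complement`, via the positions of the
letters 0 and 1 in t), so the greedy rule makes exactly these choices (`XY_succ`). The theorem then
says that if u is the prefix of t of length n, the prefix of length |σ(u)| + |u| + 1 has |u| + |u|₀
zeros, or one more (`count_zero_tribPrefix`). Ten balanced pairs, stable under σ, cut t into upper
and lower words, each lower word having the letter counts of upper word and σ-image together. At
block boundaries the counts thus agree exactly; inside a block the bound is a finite check. -/

namespace TribGame

/-! ### The Tribonacci word -/

/-- The Tribonacci morphism `0 ↦ 01`, `1 ↦ 02`, `2 ↦ 0`. -/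
def tribMor : Fin 3 → List (Fin 3) := ![[0, 1], [0, 2], [0]]

/-- The iterates of the Tribonacci morphism on the letter `0`. -/
def tribIter : ℕ → List (Fin 3)
  | 0 => [0]
  | k + 1 => (tribIter k).flatMap tribMor

/-- The Tribonacci word `0102010010201…`. -/
def trib (n : ℕ) : Fin 3 := (tribIter n).getD n 0

/-- The prefix of length `n` of the Tribonacci word. -/
def tribPrefix (n : ℕ) : List (Fin 3) := (List.range n).map trib

@[simp] theorem length_tribPrefix (n : ℕ) : (tribPrefix n).length = n := by simp [tribPrefix]

theorem tribPrefix_succ (n : ℕ) : tribPrefix (n + 1) = tribPrefix n ++ [trib n] := by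
  simp [tribPrefix, List.range_succ]

theorem flatMap_isPrefix {α β : Type*} (f : α → List β) {l m : List α} (h : l <+: m) :
    l.flatMap f <+: m.flatMap f := by
  obtain ⟨t, rfl⟩ := h
  simp

theorem tribIter_prefix_succ (k : ℕ) : tribIter k <+: tribIter (k + 1) := by
  induction k with
  | zero => exact ⟨[1], rfl⟩
  | succ k ih => exact flatMap_isPrefix tribMor ih

theorem tribIter_prefix {k m : ℕ} (h : k ≤ m) : tribIter k <+: tribIter m := by
  induction m, h using Nat.le_induction with
  | base => exact List.prefix_rfl
  | succ m _ ih => exact ih.trans (tribIter_prefix_succ m)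

theorem length_flatMap_tribMor (l : List (Fin 3)) :
    (l.flatMap tribMor).length = l.length + l.count 0 + l.count 1 := by
  induction l with
  | nil => rfl
  | cons a l ih =>
    have h : ∀ a, (tribMor a).length =
        1 + (if a == 0 then 1 else 0) + if a == 1 then 1 else 0 := by decide
    rw [List.flatMap_cons, List.length_append, ih, h, List.length_cons, List.count_cons,
      List.count_cons]
    omega

theorem count_zero_flatMap (l : List (Fin 3)) : (l.flatMap tribMor).count 0 = l.length := by
  induction l with
  | nil => rfl
  | cons a l ih =>
    have h : ∀ a, (tribMor a).count 0 = 1 := by decide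
    rw [List.flatMap_cons, List.count_append, ih, h, List.length_cons, add_comm]

theorem count_one_flatMap (l : List (Fin 3)) : (l.flatMap tribMor).count 1 = l.count 0 := by
  induction l with
  | nil => rfl
  | cons a l ih =>
    have h : ∀ a, (tribMor a).count 1 = if a == 0 then 1 else 0 := by decide
    rw [List.flatMap_cons, List.count_append, ih, h, List.count_cons, add_comm]

theorem length_flatMap_tribMor_sq (l : List (Fin 3)) :
    ((l.flatMap tribMor).flatMap tribMor).length =
      l.length + l.count 0 + (l.flatMap tribMor).length := by
  rw [length_flatMap_tribMor (l.flatMap tribMor), count_zero_flatMap, count_one_flatMap]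
  omega

theorem lt_length_tribIter (k : ℕ) : k < (tribIter k).length := by
  induction k with
  | zero => simp [tribIter]
  | succ k ih =>
    have h0 : (0 : Fin 3) ∈ tribIter k :=
      (tribIter_prefix (Nat.zero_le k)).subset (by simp [tribIter])
    have := List.count_pos_iff.2 h0
    rw [tribIter, length_flatMap_tribMor]
    omega

theorem trib_eq_getElem {k i : ℕ} (h : i < (tribIter k).length) : trib i = (tribIter k)[i] := by
  have hi := lt_length_tribIter i
  rw [trib, List.getD_eq_getElem _ _ hi]
  rw [(tribIter_prefix (le_max_left i k)).getElem hi,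
    (tribIter_prefix (le_max_right i k)).getElem h]

theorem tribIter_eq_tribPrefix (k : ℕ) : tribIter k = tribPrefix (tribIter k).length := by
  refine List.ext_getElem (by simp) fun i h _ => ?_
  simp [tribPrefix, trib_eq_getElem h]

theorem tribPrefix_prefix {m n : ℕ} (h : m ≤ n) : tribPrefix m <+: tribPrefix n := by
  induction n, h using Nat.le_induction with
  | base => exact List.prefix_rfl
  | succ n _ ih => exact ih.trans (by rw [tribPrefix_succ]; exact List.prefix_append _ _)

theorem take_tribPrefix {m n : ℕ} (h : m ≤ n) : (tribPrefix n).take m = tribPrefix m := by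
  have := List.prefix_iff_eq_take.1 (tribPrefix_prefix h)
  rw [length_tribPrefix] at this
  exact this.symm

theorem eq_tribPrefix_of_prefix {l : List (Fin 3)} {n : ℕ} (h : l <+: tribPrefix n) :
    l = tribPrefix l.length := by
  have hl := h.length_le
  rw [length_tribPrefix] at hl
  rw [← take_tribPrefix hl]
  exact List.prefix_iff_eq_take.1 h

theorem tribPrefix_prefix_tribIter (n : ℕ) : tribPrefix n <+: tribIter n := by
  rw [tribIter_eq_tribPrefix n]
  exact tribPrefix_prefix (lt_length_tribIter n).le

theorem eq_tribPrefix_of_prefix_tribIter {l : List (Fin 3)} {k : ℕ} (h : l <+: tribIter k) :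
    l = tribPrefix l.length :=
  eq_tribPrefix_of_prefix (tribIter_eq_tribPrefix k ▸ h)

theorem flatMap_tribPrefix_prefix (n : ℕ) :
    (tribPrefix n).flatMap tribMor <+: tribIter (n + 1) :=
  flatMap_isPrefix tribMor (tribPrefix_prefix_tribIter n)

theorem flatMap_flatMap_tribPrefix_prefix (n : ℕ) :
    ((tribPrefix n).flatMap tribMor).flatMap tribMor <+: tribIter (n + 2) :=
  flatMap_isPrefix tribMor (flatMap_tribPrefix_prefix n)

/-! ### Complementary sequences read off the positions of a letter -/

/-- `1 + n` plus the number of letters `a` among the first `n` letters. -/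
def letterSeq (a : Fin 3) (n : ℕ) : ℕ := 1 + n + (tribPrefix n).count a

theorem letterSeq_succ (a : Fin 3) (n : ℕ) :
    letterSeq a (n + 1) = letterSeq a n + 1 + if trib n = a then 1 else 0 := by
  simp only [letterSeq, tribPrefix_succ, List.count_append, List.count_singleton, beq_iff_eq]
  omega

theorem letterSeq_strictMono (a : Fin 3) : StrictMono (letterSeq a) :=
  strictMono_nat_of_lt_succ fun n => by rw [letterSeq_succ]; omega

theorem eq_of_count_eq {a : Fin 3} {m n : ℕ} (hm : trib m = a) (hn : trib n = a)
    (h : (tribPrefix m).count a = (tribPrefix n).count a) : m = n := by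
  have key : ∀ {m n : ℕ}, trib m = a → m < n →
      (tribPrefix m).count a < (tribPrefix n).count a := by
    intro m n hm hlt
    have := (tribPrefix_prefix (Nat.succ_le_of_lt hlt)).sublist.count_le a
    rw [Nat.succ_eq_add_one, tribPrefix_succ, List.count_append, hm, List.count_singleton_self]
      at this
    omega
  rcases lt_trichotomy m n with h' | h' | h'
  · have := key hm h'; omega
  · exact h'
  · have := key hn h'; omega

/-- The steps of `letterSeq a` are 1 or 2, and a value is skipped exactly at an occurrence of `a`.
-/
theorem letterSeq_surj (a : Fin 3) (v : ℕ) (hv : 0 < v) :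
    (∃ n, v = letterSeq a n) ∨ ∃ n, trib n = a ∧ v = letterSeq a n + 1 := by
  induction v, hv using Nat.le_induction with
  | base => exact Or.inl ⟨0, by simp [letterSeq, tribPrefix]⟩
  | succ v _ ih =>
    rcases ih with ⟨n, rfl⟩ | ⟨n, hn, rfl⟩
    · by_cases h : trib n = a
      · exact Or.inr ⟨n, h, rfl⟩
      · exact Or.inl ⟨n + 1, by simp [letterSeq_succ, h]⟩
    · exact Or.inl ⟨n + 1, by simp [letterSeq_succ, hn]⟩

theorem letterSeq_ne (a : Fin 3) {m n : ℕ} (hn : trib n = a) :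
    letterSeq a m ≠ letterSeq a n + 1 := by
  intro h
  have h1 : n < m := (letterSeq_strictMono a).lt_iff_lt.1 (by omega)
  have h2 : m < n + 1 :=
    (letterSeq_strictMono a).lt_iff_lt.1 (by rw [letterSeq_succ, if_pos hn]; omega)
  omega

/-- If `pos j` is the position of the `j`-th letter `a`, then the values `letterSeq a n` and
`2 + pos j + j` partition the positive integers. -/
theorem letterSeq_complement (a : Fin 3) (pos : ℕ → ℕ) (h1 : ∀ j, trib (pos j) = a)
    (h2 : ∀ j, (tribPrefix (pos j)).count a = j) :
    (∀ v, 0 < v → (∃ n, v = letterSeq a n) ∨ ∃ j, v = 2 + pos j + j) ∧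
      ∀ n j, letterSeq a n ≠ 2 + pos j + j := by
  have h3 : ∀ j, 2 + pos j + j = letterSeq a (pos j) + 1 := fun j => by
    rw [letterSeq, h2]; omega
  refine ⟨fun v hv => ?_, fun n j => h3 j ▸ letterSeq_ne a (h1 j)⟩
  refine (letterSeq_surj a v hv).imp id ?_
  rintro ⟨n, hn, rfl⟩
  refine ⟨(tribPrefix n).count a, ?_⟩
  rw [h3, eq_of_count_eq (h1 _) hn (h2 _)]

theorem trib_of_append_singleton_prefix {l : List (Fin 3)} {a : Fin 3} {k : ℕ}
    (h : l ++ [a] <+: tribIter k) : trib l.length = a ∧ tribPrefix l.length = l := by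
  have h' := eq_tribPrefix_of_prefix_tribIter h
  rw [List.length_append, List.length_singleton, tribPrefix_succ] at h'
  have := List.append_inj' h' rfl
  exact ⟨by simpa using this.2.symm, this.1.symm⟩

/-- The position of the `j`-th letter `0`. -/
def posZero (j : ℕ) : ℕ := ((tribPrefix j).flatMap tribMor).length

/-- The position of the `j`-th letter `1`. -/
def posOne (j : ℕ) : ℕ := (((tribPrefix j).flatMap tribMor).flatMap tribMor).length + 1

/-- Each σ(a) begins with 0 and contains no other 0. -/
theorem posZero_spec (j : ℕ) : trib (posZero j) = 0 ∧ (tribPrefix (posZero j)).count 0 = j := by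
  have h : (tribPrefix j).flatMap tribMor ++ [0] <+: tribIter (j + 2) := by
    refine List.IsPrefix.trans ?_ (flatMap_tribPrefix_prefix (j + 1))
    rw [tribPrefix_succ, List.flatMap_append, List.prefix_append_right_inj]
    generalize trib j = c
    revert c
    decide
  have := trib_of_append_singleton_prefix h
  refine ⟨this.1, ?_⟩
  rw [posZero, this.2, count_zero_flatMap, length_tribPrefix]

/-- Each σ²(a) begins with 01 and contains no other 1. -/
theorem posOne_spec (j : ℕ) : trib (posOne j) = 1 ∧ (tribPrefix (posOne j)).count 1 = j := by
  have h : (((tribPrefix j).flatMap tribMor).flatMap tribMor ++ [0]) ++ [1] <+: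
      tribIter (j + 3) := by
    refine List.IsPrefix.trans ?_ (flatMap_flatMap_tribPrefix_prefix (j + 1))
    rw [tribPrefix_succ, List.flatMap_append, List.flatMap_append, List.append_assoc,
      List.prefix_append_right_inj]
    generalize trib j = c
    revert c
    decide
  have := trib_of_append_singleton_prefix h
  rw [List.length_append, List.length_singleton] at this
  refine ⟨this.1, ?_⟩
  rw [posOne, this.2, List.count_append, count_one_flatMap, count_zero_flatMap, length_tribPrefix]
  rfl

/-! ### Closed forms for `X` and `Y` -/

/-- The closed form of `Y (n + 1)`. -/
def ySeq (n : ℕ) : ℕ := 2 + posZero n + n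

theorem ySeq_eq (n : ℕ) : ySeq n = letterSeq 0 n + letterSeq 1 n := by
  rw [ySeq, posZero, length_flatMap_tribMor, letterSeq, letterSeq, length_tribPrefix]
  omega

theorem letterSeq_zero_add_ySeq (n : ℕ) : ySeq n + letterSeq 0 n = 2 + posOne n + n := by
  rw [ySeq, posOne, length_flatMap_tribMor_sq, letterSeq, length_tribPrefix, posZero]
  omega

theorem exists_letterSeq_zero_or_ySeq (v : ℕ) (hv : 0 < v) :
    ∃ n, v = letterSeq 0 n ∨ v = ySeq n := by
  rcases (letterSeq_complement 0 posZero (fun j => (posZero_spec j).1)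
    fun j => (posZero_spec j).2).1 v hv with ⟨n, h⟩ | ⟨n, h⟩
  exacts [⟨n, Or.inl h⟩, ⟨n, Or.inr h⟩]

theorem letterSeq_zero_ne_ySeq (m n : ℕ) : letterSeq 0 m ≠ ySeq n :=
  (letterSeq_complement 0 posZero (fun j => (posZero_spec j).1)
    fun j => (posZero_spec j).2).2 m n

theorem exists_letterSeq_one_or_add (v : ℕ) (hv : 0 < v) :
    ∃ n, v = letterSeq 1 n ∨ v = ySeq n + letterSeq 0 n := by
  rcases (letterSeq_complement 1 posOne (fun j => (posOne_spec j).1)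
    fun j => (posOne_spec j).2).1 v hv with ⟨n, h⟩ | ⟨n, h⟩
  exacts [⟨n, Or.inl h⟩, ⟨n, Or.inr (h.trans (letterSeq_zero_add_ySeq n).symm)⟩]

theorem letterSeq_one_ne_add (m n : ℕ) : letterSeq 1 m ≠ ySeq n + letterSeq 0 n := by
  rw [letterSeq_zero_add_ySeq]
  exact (letterSeq_complement 1 posOne (fun j => (posOne_spec j).1)
    fun j => (posOne_spec j).2).2 m n

theorem letterSeq_pos (a : Fin 3) (n : ℕ) : 0 < letterSeq a n := by
  rw [letterSeq]; omega

/-- The set of the first `m` pairs in closed form. -/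
def firstPairs (m : ℕ) : Finset (ℕ × ℕ) :=
  (Finset.range m).image fun k => (letterSeq 0 k, ySeq k)

theorem isGood_firstPairs_iff (m x y : ℕ) : IsGood (firstPairs m) x y ↔ 0 < x ∧ x < y ∧
    ∀ k < m, (x ≠ letterSeq 0 k ∧ x ≠ ySeq k) ∧ (y ≠ letterSeq 0 k ∧ y ≠ ySeq k) ∧
      y - x ≠ letterSeq 1 k ∧ y - x ≠ ySeq k + letterSeq 0 k := by
  rw [IsGood]
  refine and_congr_right fun _ => and_congr_right fun hxy => ?_
  simp only [firstPairs, Finset.forall_mem_image, Finset.mem_range]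
  refine forall_congr' fun k => imp_congr_right fun _ =>
    and_congr Iff.rfl (and_congr Iff.rfl ?_)
  -- This turns the earlier difference `ySeq k - letterSeq 0 k` into `letterSeq 1 k`.
  have := ySeq_eq k
  omega

/-- Monotonicity excludes repeats within each sequence, and complementarity excludes coincidences
between X and Y or between differences and sums. -/
theorem isGood_closedForm (m : ℕ) : IsGood (firstPairs m) (letterSeq 0 m) (ySeq m) := by
  have hm := ySeq_eq m
  rw [isGood_firstPairs_iff]
  refine ⟨letterSeq_pos 0 m, by have := letterSeq_pos 1 m; omega, fun k hk => ?_⟩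
  have h0 := letterSeq_strictMono 0 hk
  have h1 := letterSeq_strictMono 1 hk
  have h2 := ySeq_eq k
  have h3 := letterSeq_zero_ne_ySeq m k
  have h4 := letterSeq_one_ne_add m k
  omega

/-- By covering, any smaller positive `x` is a value of X or Y, necessarily with index below `m`,
hence already used. -/
theorem letterSeq_le_of_isGood {m x y : ℕ} (h : IsGood (firstPairs m) x y) :
    letterSeq 0 m ≤ x := by
  rw [isGood_firstPairs_iff] at h
  obtain ⟨hx, -, h⟩ := h
  by_contra! hlt
  obtain ⟨k, hk⟩ := exists_letterSeq_zero_or_ySeq x hx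
  have hkm : k < m := by
    by_contra! hmk
    have := (letterSeq_strictMono 0).monotone hmk
    have := ySeq_eq k
    omega
  have := (h k hkm).1
  tauto

theorem ySeq_le_of_isGood {m y : ℕ} (h : IsGood (firstPairs m) (letterSeq 0 m) y) :
    ySeq m ≤ y := by
  rw [isGood_firstPairs_iff] at h
  obtain ⟨-, hxy, h⟩ := h
  by_contra! hlt
  have hm := ySeq_eq m
  obtain ⟨k, hk⟩ := exists_letterSeq_one_or_add (y - letterSeq 0 m) (by omega)
  have hkm : k < m := by
    by_contra! hmk
    have := (letterSeq_strictMono 1).monotone hmk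
    have := ySeq_eq k
    omega
  have := (h k hkm).2.2
  tauto

theorem nextX_firstPairs (m : ℕ) : nextX (firstPairs m) = letterSeq 0 m := by
  classical
  rw [nextX, Nat.find_eq_iff]
  refine ⟨⟨_, isGood_closedForm m⟩, ?_⟩
  rintro x hx ⟨y, hy⟩
  exact absurd (letterSeq_le_of_isGood hy) (by omega)

theorem nextY_firstPairs (m : ℕ) : nextY (firstPairs m) = ySeq m := by
  classical
  rw [nextY, Nat.find_eq_iff, nextX_firstPairs]
  refine ⟨isGood_closedForm m, fun y hy h => ?_⟩
  exact absurd (ySeq_le_of_isGood h) (by omega)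

theorem XY_succ (n : ℕ) : XY (n + 1) = (letterSeq 0 n, ySeq n) := by
  induction n using Nat.strong_induction_on with
  | _ n ih =>
    cases n with
    | zero => rw [XY]; simp [letterSeq, ySeq, posZero, tribPrefix]
    | succ n =>
      have hS : (Finset.univ.image fun k : Fin (n + 1) => XY (k.val + 1)) =
          firstPairs (n + 1) := by
        ext p
        simp only [firstPairs, Finset.mem_image, Finset.mem_univ, true_and, Finset.mem_range]
        constructor
        · rintro ⟨k, rfl⟩
          exact ⟨k, k.2, (ih k k.2).symm⟩
        · rintro ⟨k, hk, rfl⟩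
          exact ⟨⟨k, hk⟩, ih k hk⟩
      rw [XY]
      simp only [hS, nextX_firstPairs, nextY_firstPairs]

theorem X_succ (n : ℕ) : X (n + 1) = letterSeq 0 n := by rw [X, XY_succ]

theorem Y_succ (n : ℕ) : Y (n + 1) = ySeq n := by rw [Y, XY_succ]

/-! ### Balanced pairs -/

/-- The upper words of the balanced pairs. -/
def upperWord : Fin 10 → List (Fin 3) :=
  ![[0], [1], [0], [2], [1], [0, 2], [1, 0], [2], [0], [0, 1]]

/-- The lower words of the balanced pairs. The numbers of letters in `lowerWord i` are those in
`upperWord i` and its image under the Tribonacci morphism together. -/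
def lowerWord : Fin 10 → List (Fin 3) :=
  ![[0, 1, 0], [2, 0, 1], [0, 0, 1], [0, 2], [1, 0, 2], [0, 2, 0, 1, 0], [0, 1, 0, 2, 0, 1],
    [2, 0], [1, 0, 0], [0, 2, 0, 1, 0, 1]]

/-- The decomposition into balanced pairs of the image of a balanced pair. -/
def pairMor : Fin 10 → List (Fin 10) :=
  ![[0, 1], [2, 3], [0, 4], [0], [5], [0, 6], [0, 7, 8, 4], [2], [9], [0, 6, 3]]

theorem upperWord_flatMap (i : Fin 10) :
    (upperWord i).flatMap tribMor = (pairMor i).flatMap upperWord := by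
  revert i; decide

theorem lowerWord_flatMap (i : Fin 10) :
    (lowerWord i).flatMap tribMor = (pairMor i).flatMap lowerWord := by
  revert i; decide

/-- The decomposition into balanced pairs of the iterated images of the first balanced pair. -/
def pairIter : ℕ → List (Fin 10)
  | 0 => [0]
  | k + 1 => (pairIter k).flatMap pairMor

theorem flatMap_upperWord (k : ℕ) : (pairIter k).flatMap upperWord = tribIter k := by
  induction k with
  | zero => rfl
  | succ k ih =>
    simp only [pairIter, tribIter, ← ih, List.flatMap_assoc, upperWord_flatMap]

/-- The lower word 010 of the first pair is a prefix of σ²(0) = 0102; applying σ preserves the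
prefix relation. -/
theorem flatMap_lowerWord (k : ℕ) : (pairIter k).flatMap lowerWord <+: tribIter (k + 2) := by
  induction k with
  | zero => exact ⟨[2], by decide⟩
  | succ k ih =>
    have := flatMap_isPrefix tribMor ih
    simpa only [pairIter, tribIter, List.flatMap_assoc, lowerWord_flatMap] using this

/-- The length of the lower word of a balanced pair with upper word `l`. -/
def lowerLength (l : List (Fin 3)) : ℕ := (l.flatMap tribMor).length + l.length

theorem lowerLength_append (l m : List (Fin 3)) :
    lowerLength (l ++ m) = lowerLength l + lowerLength m := by
  simp only [lowerLength, List.flatMap_append, List.length_append]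
  omega

theorem lowerLength_upperWord (i : Fin 10) :
    lowerLength (upperWord i) = (lowerWord i).length := by
  revert i; decide

theorem count_zero_lowerWord (i : Fin 10) :
    (lowerWord i).count 0 = (upperWord i).length + (upperWord i).count 0 := by
  revert i; decide

theorem count_take_lowerWord (i : Fin 10) (n : ℕ) (hn : n < (upperWord i).length) :
    let L := lowerLength ((upperWord i).take n)
    let c := ((lowerWord i).take (L + 1)).count 0
    let e := n + ((upperWord i).take n).count 0
    L + 1 ≤ (lowerWord i).length ∧ (c = e ∨ c = e + 1) := by
  have h2 : (upperWord i).length ≤ 2 := by clear hn; revert i; decide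
  have hn2 : n < 2 := by omega
  have key : ∀ n : Fin 2, ∀ i : Fin 10, n < (upperWord i).length →
      let L := lowerLength ((upperWord i).take n)
      let c := ((lowerWord i).take (L + 1)).count 0
      let e := n + ((upperWord i).take n).count 0
      L + 1 ≤ (lowerWord i).length ∧ (c = e ∨ c = e + 1) := by decide
  exact key ⟨n, hn2⟩ i hn

/-- Complete blocks contribute equally to both counts, so they can be stripped off until `n` falls
inside the first block. -/
theorem count_take_flatMap_lowerWord (w : List (Fin 10)) (n : ℕ)
    (hn : n < (w.flatMap upperWord).length) :
    let L := lowerLength ((w.flatMap upperWord).take n)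
    let c := ((w.flatMap lowerWord).take (L + 1)).count 0
    let e := n + ((w.flatMap upperWord).take n).count 0
    L + 1 ≤ (w.flatMap lowerWord).length ∧ (c = e ∨ c = e + 1) := by
  induction w generalizing n with
  | nil => simp at hn
  | cons i w ih =>
    simp only [List.flatMap_cons, List.length_append] at hn ⊢
    rcases lt_or_ge n (upperWord i).length with h | h
    · have := count_take_lowerWord i n h
      simp only at this
      rw [List.take_append_of_le_length h.le, List.take_append_of_le_length this.1]
      exact ⟨by omega, this.2⟩
    · obtain ⟨m, rfl⟩ := Nat.exists_eq_add_of_le h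
      have := ih m (by omega)
      simp only at this
      rw [List.take_length_add_append, lowerLength_append, lowerLength_upperWord, add_assoc,
        List.take_length_add_append, List.count_append, List.count_append, count_zero_lowerWord]
      omega

theorem count_zero_tribPrefix (n : ℕ) :
    (tribPrefix (posZero n + n + 1)).count 0 = n + (tribPrefix n).count 0 ∨
      (tribPrefix (posZero n + n + 1)).count 0 = n + (tribPrefix n).count 0 + 1 := by
  have hn : n < ((pairIter n).flatMap upperWord).length := by
    rw [flatMap_upperWord]; exact lt_length_tribIter n
  have hu : ((pairIter n).flatMap upperWord).take n = tribPrefix n := by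
    rw [flatMap_upperWord, tribIter_eq_tribPrefix, take_tribPrefix (lt_length_tribIter n).le]
  have h := count_take_flatMap_lowerWord (pairIter n) n hn
  simp only [hu] at h
  have hL : lowerLength (tribPrefix n) = posZero n + n := by
    rw [lowerLength, posZero, length_tribPrefix]
  rw [hL, eq_tribPrefix_of_prefix_tribIter (flatMap_lowerWord n), length_tribPrefix] at h
  rw [take_tribPrefix h.1] at h
  exact h.2

theorem X_Y_succ (n : ℕ) : X (Y (n + 1)) = X (n + 1) + Y (n + 1) ∨
    X (Y (n + 1)) + 1 = X (n + 1) + Y (n + 1) := by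
  -- The index shift in `X_succ` leaves `letterSeq 0` at `posZero n + n + 1`, the prefix length in
  -- `count_zero_tribPrefix`.
  have hY : Y (n + 1) = posZero n + n + 1 + 1 := by rw [Y_succ, ySeq]; omega
  rw [hY, X_succ, X_succ, letterSeq, letterSeq]
  have := count_zero_tribPrefix n
  omega

end TribGame

theorem mainTheorem2 (n : ℕ) (hn : 1 ≤ n) :
    (TribGame.X (TribGame.Y n) : ℤ) = TribGame.X n + TribGame.Y n ∨
      (TribGame.X (TribGame.Y n) : ℤ) = TribGame.X n + TribGame.Y n - 1 := by
  obtain ⟨m, rfl⟩ := Nat.exists_eq_add_of_le' hn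
  have := TribGame.X_Y_succ m
  omega
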